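/- Let $n\ge 2$. Let $D^m\subset\mathbb R^m$ be the closed Euclidean unit disc and let $\mathrm{Rect}(D^m,D^m)$ be the topological monoid of maps $D^m\to D^m$ of the form $x\mapsto rx+b$ with $r>0$, with the compact-open topology. Let $\mathcal P_{\mathsf{CD}_n}$ be the topological symmetric operad whose space of $k$-ary operations ($k\ge 0$) consists of the $k$-tuples $(f_1,\dots,f_k)$ in $\mathrm{Rect}(D^n,D^n)$ whose images are pairwise causally disjoint in Minkowski space $\mathbb R^{1,n-1}$, i.e. for $i\ne j$ no causal curve joins a point of $f_i(D^n)$ to a point of $f_j(D^n)$. (A causal curve is a differentiable curve on a compact interval all of whose velocities are timelike or null, in particular nonzero; every point counts as joined to itself.) Let $\mathcal P_{\mathsf{Disc}_{m}}$ be the topological symmetric operad whose space of $k$-ary operations consists of the $k$-tuples in $\mathrm{Rect}(D^{m},D^{m})$ whose images have pairwise disjoint interiors in $\mathbb R^{m}$. In both cases the operadic composition is induced by composition of maps, and the symmetric groups permute the entries. Then the operads $\mathcal P_{\mathsf{CD}_n}$ and $\mathcal P_{\mathsf{Disc}_{n-1}}$ are homotopy equivalent; more precisely, there is a morphism of topological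 symmetric operads $\mathcal P_{\mathsf{CD}_n}\to\mathcal P_{\mathsf{Disc}_{n-1}}$ that is a homotopy equivalence of spaces in each arity. Moreover $\mathcal P_{\mathsf{Disc}_{n-1}}$ is an $\mathbb E_{n-1}$-operad, i.e. it is connected to the operad of little $(n-1)$-cubes by a finite zigzag of morphisms of topological symmetric operads that are homotopy equivalences in each arity. -/

import Mathlib

open scoped Topology

namespace CausalDiscs

/-! ### Topological symmetric operads -/

/-- A (one-coloured) symmetric operad in topological spaces, in coordinate-free form: the space of
operations `P I` is given for every finite set `I` of inputs, `P k` in the usual notation is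
`P (Fin k)`, the symmetric group actions are the functoriality `map` in bijections of finite sets,
and the composite of `f` in `P I` with `g i` in `P (J i)` lies in `P (Σ i, J i)`.
Nullary operations are included. -/
structure TopOperad where
  space : (I : Type) → [Finite I] → Type
  [top : (I : Type) → [Finite I] → TopologicalSpace (space I)]
  map : {I J : Type} → [Finite I] → [Finite J] → (I ≃ J) → space I → space J
  one : space Unit
  comp : {I : Type} → [Finite I] → {J : I → Type} → [∀ i, Finite (J i)] →
    space I → (∀ i, space (J i)) → space (Σ i, J i)
  continuous_map : ∀ {I J : Type} [Finite I] [Finite J] (e : I ≃ J), Continuous (map e)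
  continuous_comp : ∀ {I : Type} [Finite I] {J : I → Type} [∀ i, Finite (J i)],
    Continuous (fun x : space I × (∀ i, space (J i)) => comp x.1 x.2)
  map_refl : ∀ {I : Type} [Finite I] (f : space I), map (Equiv.refl I) f = f
  map_trans : ∀ {I J K : Type} [Finite I] [Finite J] [Finite K] (e : I ≃ J) (e' : J ≃ K)
    (f : space I), map (e.trans e') f = map e' (map e f)
  comp_one : ∀ {I : Type} [Finite I] (f : space I),
    map (Equiv.sigmaUnique I (fun _ => Unit)) (comp f (fun _ => one)) = f
  one_comp : ∀ {I : Type} [Finite I] (f : space I),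
    map (Equiv.uniqueSigma (fun _ : Unit => I)) (comp one (fun _ => f)) = f
  assoc : ∀ {I : Type} [Finite I] {J : I → Type} [∀ i, Finite (J i)]
    {K : ∀ i, J i → Type} [∀ i j, Finite (K i j)]
    (f : space I) (g : ∀ i, space (J i)) (h : ∀ i j, space (K i j)),
    map (Equiv.sigmaAssoc K)
        (comp (J := fun p : (Σ i, J i) => K p.1 p.2) (comp f g) (fun p => h p.1 p.2)) =
      comp f (fun i => comp (g i) (h i))
  equivariant : ∀ {I I' : Type} [Finite I] [Finite I'] {J : I → Type} [∀ i, Finite (J i)]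
    {J' : I' → Type} [∀ i, Finite (J' i)] (e : I ≃ I') (e' : ∀ i, J i ≃ J' (e i))
    (f : space I) (g : ∀ i, space (J i)) (g' : ∀ i, space (J' i)),
    (∀ i, g' (e i) = map (e' i) (g i)) →
    comp (map e f) g' = map (Equiv.sigmaCongr e e') (comp f g)

attribute [instance] TopOperad.top

/-- Morphisms of topological symmetric operads. -/
structure TopOperad.Hom (P Q : TopOperad) where
  app : (I : Type) → [Finite I] → C(P.space I, Q.space I)
  app_map : ∀ {I J : Type} [Finite I] [Finite J] (e : I ≃ J) (f : P.space I),
    app J (P.map e f) = Q.map e (app I f)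
  app_one : app Unit P.one = Q.one
  app_comp : ∀ {I : Type} [Finite I] {J : I → Type} [∀ i, Finite (J i)]
    (f : P.space I) (g : ∀ i, P.space (J i)),
    app (Σ i, J i) (P.comp f g) = Q.comp (app I f) (fun i => app (J i) (g i))

/-- A morphism of operads is an equivalence when it is a homotopy equivalence in every arity. -/
def TopOperad.Hom.IsEquivalence {P Q : TopOperad} (φ : P.Hom Q) : Prop :=
  ∀ (I : Type) [Finite I],
    ∃ e : ContinuousMap.HomotopyEquiv (P.space I) (Q.space I), e.toFun = φ.app I

/-- Two operads are homotopy equivalent when they are connected by a finite zigzag of operad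
morphisms that are homotopy equivalences in every arity. -/
def TopOperad.HomotopyEquivalent (P Q : TopOperad) : Prop :=
  Relation.EqvGen (fun A B : TopOperad => ∃ φ : A.Hom B, φ.IsEquivalence) P Q

/-! ### Orthogonal categories with one object and their prefactorization operads -/

/-- A topologically enriched orthogonal category with one object: a topological monoid `End` (of
endomorphisms of the object) with a symmetric relation `perp` stable under composition. -/
structure OrthMonoid where
  End : Type
  [monoid : Monoid End]
  [top : TopologicalSpace End]
  [continuousMul : ContinuousMul End]
  perp : End → End → Prop
  symm : ∀ {f₁ f₂ : End}, perp f₁ f₂ → perp f₂ f₁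
  stable : ∀ {f₁ f₂ : End} (g h₁ h₂ : End), perp f₁ f₂ → perp (g * f₁ * h₁) (g * f₂ * h₂)

attribute [instance] OrthMonoid.monoid OrthMonoid.top OrthMonoid.continuousMul

/-- The prefactorization operad: operations with inputs `I` are families `(f i)` of endomorphisms
with `f i` and `f j` orthogonal for `i ≠ j`, with the topology of a subspace of the product. -/
def OrthMonoid.prefact (C : OrthMonoid) : TopOperad where
  space I _ := {f : I → C.End // ∀ i j, i ≠ j → C.perp (f i) (f j)}
  map e f := ⟨fun j => f.1 (e.symm j), fun i j h => f.2 _ _ (fun h' => h (e.symm.injective h'))⟩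
  one := ⟨fun _ => 1, fun i j h => absurd (Subsingleton.elim i j) h⟩
  comp f g := ⟨fun p => f.1 p.1 * (g p.1).1 p.2, by
    rintro ⟨i, a⟩ ⟨j, b⟩ h
    by_cases hij : i = j
    · subst hij
      have hab : a ≠ b := fun hab => h (by rw [hab])
      simpa using C.stable (f.1 i) 1 1 ((g i).2 a b hab)
    · simpa using C.stable 1 ((g i).1 a) ((g j).1 b) (f.2 i j hij)⟩
  continuous_map e := by
    refine Continuous.subtype_mk (continuous_pi fun j => ?_) _
    exact (continuous_apply (e.symm j)).comp continuous_subtype_val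
  continuous_comp := by
    refine Continuous.subtype_mk (continuous_pi fun p => Continuous.mul ?_ ?_) _
    · exact (continuous_apply p.1).comp (continuous_subtype_val.comp continuous_fst)
    · exact (continuous_apply p.2).comp
        (continuous_subtype_val.comp ((continuous_apply p.1).comp continuous_snd))
  map_refl f := rfl
  map_trans e e' f := rfl
  comp_one f := by
    apply Subtype.ext
    funext i
    simp [Equiv.sigmaUnique]
  one_comp f := by
    apply Subtype.ext
    funext i
    simp [Equiv.uniqueSigma]
  assoc f g h := by
    apply Subtype.ext
    funext p
    simp [Equiv.sigmaAssoc, mul_assoc]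
  equivariant := by
    intro I I' _ _ J _ J' _ e e' f g g' hg
    apply Subtype.ext
    funext p
    obtain ⟨⟨i, a⟩, rfl⟩ := (Equiv.sigmaCongr e e').surjective p
    have h2 := congrArg (fun q => q.1 (e' i a)) (hg i)
    simp only [Equiv.symm_apply_apply] at h2
    have h3 : f.1 (e.symm (e i)) * (g' (e i)).1 (e' i a) =
        f.1 ((Equiv.sigmaCongr e e').symm (Equiv.sigmaCongr e e' ⟨i, a⟩)).1 *
          (g ((Equiv.sigmaCongr e e').symm (Equiv.sigmaCongr e e' ⟨i, a⟩)).1).1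
            ((Equiv.sigmaCongr e e').symm (Equiv.sigmaCongr e e' ⟨i, a⟩)).2 := by
      rw [Equiv.symm_apply_apply, Equiv.symm_apply_apply, h2]
    exact h3

/-! ### Rectilinear embeddings of the closed unit disc -/

/-- `ℝⁿ` with the Euclidean norm. As Minkowski space its coordinate with index `0` is time. -/
abbrev E (n : ℕ) : Type := EuclideanSpace ℝ (Fin n)

/-- The closed Euclidean unit disc. -/
abbrev Disc (n : ℕ) : Type := Metric.closedBall (0 : E n) 1

/-- Rectilinear self-embeddings `x ↦ r x + b`, `r > 0`, of the closed unit disc; as a subspace of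
`C(Disc n, Disc n)` they carry the compact-open topology. -/
def Rect (n : ℕ) : Type :=
  {f : C(Disc n, Disc n) // ∃ r : ℝ, 0 < r ∧ ∃ b : E n, ∀ x : Disc n, (f x : E n) = r • (x : E n) + b}

instance (n : ℕ) : TopologicalSpace (Rect n) :=
  inferInstanceAs (TopologicalSpace (Subtype _))

instance (n : ℕ) : Monoid (Rect n) where
  one := ⟨ContinuousMap.id _, 1, one_pos, 0, fun x => by simp⟩
  mul f g := ⟨f.1.comp g.1, by
    obtain ⟨r, hr, b, hf⟩ := f.2
    obtain ⟨s, hs, c, hg⟩ := g.2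
    exact ⟨r * s, mul_pos hr hs, r • c + b, fun x => by
      rw [ContinuousMap.comp_apply, hf, hg, smul_add, smul_smul, add_assoc]⟩⟩
  mul_assoc _ _ _ := rfl
  one_mul _ := rfl
  mul_one _ := rfl

instance (n : ℕ) : ContinuousMul (Rect n) where
  continuous_mul := Continuous.subtype_mk
    ((continuous_subtype_val.comp continuous_fst).compCM
      (continuous_subtype_val.comp continuous_snd)) _

/-- The image of a rectilinear embedding, as a subset of `ℝⁿ`. -/
def Rect.image {n : ℕ} (f : Rect n) : Set (E n) := Set.range fun x : Disc n => (f.1 x : E n)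

theorem Rect.image_mul_subset {n : ℕ} (f h : Rect n) : (f * h).image ⊆ f.image := by
  rintro _ ⟨x, rfl⟩
  exact ⟨h.1 x, rfl⟩

theorem Rect.exists_image_mul {n : ℕ} (g : Rect n) : ∃ r : ℝ, 0 < r ∧ ∃ b : E n,
    ∀ f : Rect n, (g * f).image = (fun x => r • x + b) '' f.image := by
  obtain ⟨r, hr, b, hg⟩ := g.2
  refine ⟨r, hr, b, fun f => ?_⟩
  rw [Rect.image, Rect.image, ← Set.range_comp]
  congr 1
  funext x
  exact hg (f.1 x)

/-! ### Causal structure of Minkowski space -/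

/-- The Minkowski metric `-x₀y₀ + x₁y₁ + ⋯` on `ℝⁿ`. -/
def minkowski {n : ℕ} (x y : E n) : ℝ :=
  ∑ i : Fin n, (if (i : ℕ) = 0 then -1 else 1) * (x i * y i)

/-- `γ` restricts to a causal curve on `[a, b]`: it is differentiable and all its velocities are
timelike or null (hence nonzero). -/
def IsCausalCurveOn {n : ℕ} (γ : ℝ → E n) (a b : ℝ) : Prop :=
  ∀ t ∈ Set.Icc a b, ∃ v : E n,
    HasDerivWithinAt γ v (Set.Icc a b) t ∧ v ≠ 0 ∧ minkowski v v ≤ 0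

/-- `p` and `q` are joined by a causal curve. The one-point interval is allowed: every point is
joined to itself. -/
def CausallyJoined {n : ℕ} (p q : E n) : Prop :=
  ∃ (γ : ℝ → E n) (a b : ℝ), a ≤ b ∧ IsCausalCurveOn γ a b ∧
    ((γ a = p ∧ γ b = q) ∨ (γ a = q ∧ γ b = p))

/-- No causal curve joins a point of `S` to a point of `T`. -/
def CausallyDisjoint {n : ℕ} (S T : Set (E n)) : Prop :=
  ∀ p ∈ S, ∀ q ∈ T, ¬ CausallyJoined p q

theorem CausallyJoined.symm {n : ℕ} {p q : E n} (h : CausallyJoined p q) : CausallyJoined q p := by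
  obtain ⟨γ, a, b, hab, hγ, h⟩ := h
  exact ⟨γ, a, b, hab, hγ, h.symm⟩

theorem CausallyDisjoint.image {n : ℕ} {S T : Set (E n)} (h : CausallyDisjoint S T) {r : ℝ}
    (hr : 0 < r) (b : E n) :
    CausallyDisjoint ((fun x => r • x + b) '' S) ((fun x => r • x + b) '' T) := by
  rintro _ ⟨p, hp, rfl⟩ _ ⟨q, hq, rfl⟩ ⟨γ, s, t, hst, hγ, hends⟩
  have key : ∀ x y : E n, y = r • x + b → r⁻¹ • (y - b) = x := by
    rintro x _ rfl
    rw [add_sub_cancel_right, smul_smul, inv_mul_cancel₀ hr.ne', one_smul]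
  refine h p hp q hq ⟨fun u => r⁻¹ • (γ u - b), s, t, hst, fun u hu => ?_, ?_⟩
  · obtain ⟨v, hv, hv0, hvm⟩ := hγ u hu
    refine ⟨r⁻¹ • v, (hv.sub_const b).const_smul r⁻¹, smul_ne_zero (inv_ne_zero hr.ne') hv0, ?_⟩
    have : minkowski (r⁻¹ • v) (r⁻¹ • v) = (r⁻¹ * r⁻¹) * minkowski v v := by
      simp only [minkowski, Finset.mul_sum, PiLp.smul_apply, smul_eq_mul]
      exact Finset.sum_congr rfl fun i _ => by ring
    rw [this]
    exact mul_nonpos_of_nonneg_of_nonpos (mul_self_nonneg _) hvm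
  · rcases hends with ⟨h1, h2⟩ | ⟨h1, h2⟩
    · exact Or.inl ⟨key _ _ h1, key _ _ h2⟩
    · exact Or.inr ⟨key _ _ h1, key _ _ h2⟩

/-! ### The operads -/

theorem disjoint_interior_image {X : Type*} [TopologicalSpace X] {S T S' T' : Set X} (φ : X ≃ₜ X)
    (h : Disjoint (interior S) (interior T)) (hS : S' ⊆ φ '' S) (hT : T' ⊆ φ '' T) :
    Disjoint (interior S') (interior T') := by
  refine Set.disjoint_of_subset (interior_mono hS) (interior_mono hT) ?_
  rw [← φ.image_interior, ← φ.image_interior]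
  exact (Set.disjoint_image_iff φ.injective).2 h

/-- Causally disjoint discs in `n`-dimensional Minkowski space. -/
def CD (n : ℕ) : OrthMonoid where
  End := Rect n
  perp f g := CausallyDisjoint f.image g.image
  symm h := fun p hp q hq hpq => h q hq p hp hpq.symm
  stable {f₁ f₂} g h₁ h₂ h := by
    obtain ⟨r, hr, b, hg⟩ := g.exists_image_mul
    rw [mul_assoc, mul_assoc, hg, hg]
    refine CausallyDisjoint.image (fun p hp q hq => ?_) hr b
    exact h p (f₁.image_mul_subset h₁ hp) q (f₂.image_mul_subset h₂ hq)

/-- Discs in `ℝⁿ` with disjoint interiors. -/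
def Discs (n : ℕ) : OrthMonoid where
  End := Rect n
  perp f g := Disjoint (interior f.image) (interior g.image)
  symm h := h.symm
  stable {f₁ f₂} g h₁ h₂ h := by
    obtain ⟨r, hr, b, hg⟩ := g.exists_image_mul
    refine disjoint_interior_image
      ((Homeomorph.smulOfNeZero r hr.ne').trans (Homeomorph.addRight b)) h ?_ ?_
    · exact ((g * f₁).image_mul_subset h₁).trans (hg f₁).subset
    · exact ((g * f₂).image_mul_subset h₂).trans (hg f₂).subset

/-- The operad of causally disjoint discs. -/
def PCD (n : ℕ) : TopOperad := (CD n).prefact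

/-- The operad of little `n`-discs. -/
def PDisc (n : ℕ) : TopOperad := (Discs n).prefact

/-! ### Little cubes and `E_m`-operads -/

/-- The cube `[-1, 1]ᵐ`. -/
abbrev Cube (m : ℕ) : Type := Set.Icc (-1 : Fin m → ℝ) 1

/-- Self-embeddings `x ↦ (aᵢ xᵢ + bᵢ)ᵢ`, `aᵢ > 0`, of the cube, with the compact-open topology. -/
def CubeEmb (m : ℕ) : Type :=
  {f : C(Cube m, Cube m) // ∃ a : Fin m → ℝ, (∀ i, 0 < a i) ∧ ∃ b : Fin m → ℝ,
    ∀ x : Cube m, (f x : Fin m → ℝ) = a * (x : Fin m → ℝ) + b}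

instance (m : ℕ) : TopologicalSpace (CubeEmb m) :=
  inferInstanceAs (TopologicalSpace (Subtype _))

instance (m : ℕ) : Monoid (CubeEmb m) where
  one := ⟨ContinuousMap.id _, 1, fun _ => one_pos, 0, fun x => by simp⟩
  mul f g := ⟨f.1.comp g.1, by
    obtain ⟨a, ha, b, hf⟩ := f.2
    obtain ⟨a', ha', b', hg⟩ := g.2
    exact ⟨a * a', fun i => mul_pos (ha i) (ha' i), a * b' + b, fun x => by
      rw [ContinuousMap.comp_apply, hf, hg, mul_add, mul_assoc, add_assoc]⟩⟩
  mul_assoc _ _ _ := rfl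
  one_mul _ := rfl
  mul_one _ := rfl

instance (m : ℕ) : ContinuousMul (CubeEmb m) where
  continuous_mul := Continuous.subtype_mk
    ((continuous_subtype_val.comp continuous_fst).compCM
      (continuous_subtype_val.comp continuous_snd)) _

/-- The image of a little cube, as a subset of `ℝᵐ`. -/
def CubeEmb.image {m : ℕ} (f : CubeEmb m) : Set (Fin m → ℝ) :=
  Set.range fun x : Cube m => (f.1 x : Fin m → ℝ)

/-- Cubes in `ℝᵐ` with disjoint interiors. -/
def Cubes (m : ℕ) : OrthMonoid where
  End := CubeEmb m
  perp f g := Disjoint (interior f.image) (interior g.image)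
  symm h := h.symm
  stable {f₁ f₂} g h₁ h₂ h := by
    obtain ⟨a, ha, b, hg⟩ := g.2
    have key : ∀ f k : CubeEmb m, (g * f * k).image ⊆
        ((Homeomorph.piCongrRight fun i => Homeomorph.mulLeft₀ (a i) (ha i).ne').trans
          (Homeomorph.addRight b)) '' f.image := by
      rintro f k _ ⟨x, rfl⟩
      exact ⟨(f.1 (k.1 x) : Fin m → ℝ), ⟨k.1 x, rfl⟩, (hg (f.1 (k.1 x))).symm⟩
    exact disjoint_interior_image _ h (key f₁ h₁) (key f₂ h₂)

/-- The operad of little `m`-cubes. -/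
def PCube (m : ℕ) : TopOperad := (Cubes m).prefact

/-- An `E_m`-operad is an operad that is homotopy equivalent to the operad of little `m`-cubes. -/
def TopOperad.IsEOperad (m : ℕ) (P : TopOperad) : Prop := P.HomotopyEquivalent (PCube m)

end CausalDiscs

namespace CausalDiscs

open scoped unitInterval

/-! ### Morphisms of orthogonal monoids -/

/-! An operation of a prefactorization operad is a family of endomorphisms subject only to a
pairwise relation. A continuous, relation-preserving map of endomorphism monoids therefore acts
entrywise on operations in every arity, and so does a homotopy through such maps. Only the operad
morphism itself must be multiplicative; its homotopy inverse and the homotopies need not be. Both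
equivalences thus reduce to inequalities about pairs of discs (`OrthMonoid.Hom.isEquivalence`).

Causal discs. In Minkowski space two points are causally joined exactly when their spatial distance
is at most their time difference (`causallyJoined_iff`). Since |t| + ‖y‖ has maximum √2 on the
Euclidean unit ball, discs with centers (t, y), (t', y') and radii r, r' are causally disjoint iff
|t - t'| + √2 (r + r') < ‖y - y'‖ (`causallyDisjoint_closedBall_iff`). Dropping the time coordinate
of the center is then a morphism to discs with disjoint interiors. An inverse up to homotopy puts
the disc of half the radius on the slice t = 0; since √2 / 2 < 1, disjoint interiors become causal
disjointness. Scaling times and radii linearly gives the homotopies.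

Discs and cubes. These are joined by a span through an intermediate operad. The norms N_s = (1 - s)
‖·‖₂ + s ‖·‖_∞ interpolate between the disc and the cube, and an operation of the intermediate
operad is a path in s of configurations of N_s-balls inside the unit N_s-ball. Evaluation at s = 0
and s = 1 gives morphisms to little discs and to little cubes. Each is an equivalence because a
configuration for one norm, once shrunk by a controlled distortion factor, is a configuration for
any other (`DiscPath.adjust`, `interpNorm_le_distortion_mul`). A path can thus be contracted onto
either of its ends. At the cube end the side lengths must in addition be made equal, by shrinking
them to their minimum. -/

/-- Continuous monoid homomorphisms that preserve orthogonality. -/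
structure OrthMonoid.Hom (C D : OrthMonoid) where
  toMonoidHom : C.End →* D.End
  continuous : Continuous toMonoidHom
  map_perp : ∀ {f g : C.End}, C.perp f g → D.perp (toMonoidHom f) (toMonoidHom g)

/-- The morphism of prefactorization operads induced by a morphism of orthogonal monoids. -/
def OrthMonoid.Hom.prefact {C D : OrthMonoid} (φ : C.Hom D) : C.prefact.Hom D.prefact where
  app _ _ :=
    { toFun := fun f => ⟨fun i => φ.toMonoidHom (f.1 i), fun i j h => φ.map_perp (f.2 i j h)⟩
      continuous_toFun := Continuous.subtype_mk (continuous_pi fun i =>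
        φ.continuous.comp ((continuous_apply i).comp continuous_subtype_val)) _ }
  app_map _ _ := rfl
  app_one := Subtype.ext (funext fun _ => map_one φ.toMonoidHom)
  app_comp _ _ := Subtype.ext (funext fun _ => map_mul φ.toMonoidHom _ _)

/-- Homotopies through orthogonality-preserving maps. -/
def OrthMonoid.PerpHomotopic {C D : OrthMonoid} (f g : C.End → D.End) : Prop :=
  ∃ H : I × C.End → D.End, Continuous H ∧
    (∀ u x y, C.perp x y → D.perp (H (u, x)) (H (u, y))) ∧
    (∀ x, H (0, x) = f x) ∧ ∀ x, H (1, x) = g x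

/-- The map on operations induced by an orthogonality-preserving map. -/
def OrthMonoid.prefactMap {C D : OrthMonoid} (ψ : C.End → D.End) (hc : Continuous ψ)
    (hp : ∀ x y, C.perp x y → D.perp (ψ x) (ψ y)) (J : Type) [Finite J] :
    C(C.prefact.space J, D.prefact.space J) where
  toFun f := ⟨fun i => ψ (f.1 i), fun i j h => hp _ _ (f.2 i j h)⟩
  continuous_toFun := Continuous.subtype_mk (continuous_pi fun i =>
    hc.comp ((continuous_apply i).comp continuous_subtype_val)) _

theorem OrthMonoid.PerpHomotopic.homotopic {C D : OrthMonoid} {f g : C.End → D.End}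
    (h : OrthMonoid.PerpHomotopic f g) {J : Type} [Finite J]
    {F G : C(C.prefact.space J, D.prefact.space J)}
    (hF : ∀ x i, (F x).1 i = f (x.1 i)) (hG : ∀ x i, (G x).1 i = g (x.1 i)) :
    F.Homotopic G := by
  obtain ⟨H, hc, hp, h0, h1⟩ := h
  refine ⟨⟨⟨fun p => ⟨fun i => H (p.1, p.2.1 i), fun i j h => hp _ _ _ (p.2.2 i j h)⟩, ?_⟩,
    fun x => ?_, fun x => ?_⟩⟩
  · refine Continuous.subtype_mk (continuous_pi fun i => hc.comp (continuous_fst.prodMk ?_)) _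
    exact (continuous_apply i).comp (continuous_subtype_val.comp continuous_snd)
  · exact Subtype.ext (funext fun i => (h0 _).trans (hF x i).symm)
  · exact Subtype.ext (funext fun i => (h1 _).trans (hG x i).symm)

/-- A morphism with an orthogonality-preserving homotopy inverse induces an equivalence of
operads. -/
theorem OrthMonoid.Hom.isEquivalence {C D : OrthMonoid} (φ : C.Hom D) (ψ : D.End → C.End)
    (hc : Continuous ψ) (hp : ∀ x y, D.perp x y → C.perp (ψ x) (ψ y))
    (hl : OrthMonoid.PerpHomotopic (C := C) (D := C) (fun x => ψ (φ.toMonoidHom x)) id)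
    (hr : OrthMonoid.PerpHomotopic (C := D) (D := D) (fun x => φ.toMonoidHom (ψ x)) id) :
    φ.prefact.IsEquivalence := fun J _ =>
  ⟨⟨φ.prefact.app J, OrthMonoid.prefactMap ψ hc hp J,
    hl.homotopic (fun _ _ => rfl) (fun _ _ => rfl),
    hr.homotopic (fun _ _ => rfl) (fun _ _ => rfl)⟩, rfl⟩

/-! ### Coordinates on rectilinear embeddings -/

namespace Rect

variable {m : ℕ}

/-- The image of the origin. -/
def center (f : Rect m) : E m := f.1 ⟨0, by simp⟩

/-- The scaling factor. -/
noncomputable def radius (f : Rect m) : ℝ := f.2.choose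

theorem radius_pos (f : Rect m) : 0 < f.radius := f.2.choose_spec.1

theorem apply_eq (f : Rect m) (x : Disc m) : (f.1 x : E m) = f.radius • (x : E m) + f.center := by
  obtain ⟨b, hb⟩ := f.2.choose_spec.2
  have h0 : f.center = b := by rw [center, hb]; simp
  rw [h0, hb]; rfl

/-- The embedding with given radius and center. -/
def mk (r : ℝ) (b : E m) (hr : 0 < r) (h : ‖b‖ + r ≤ 1) : Rect m :=
  ⟨⟨fun x => ⟨r • (x : E m) + b, by
      have hx : ‖(x : E m)‖ ≤ 1 := mem_closedBall_zero_iff.1 x.2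
      rw [mem_closedBall_zero_iff]
      calc ‖r • (x : E m) + b‖ ≤ ‖r • (x : E m)‖ + ‖b‖ := norm_add_le _ _
        _ ≤ r + ‖b‖ := by
          rw [norm_smul, Real.norm_of_nonneg hr.le]
          nlinarith
        _ ≤ 1 := by linarith⟩,
    by fun_prop⟩, r, hr, b, fun _ => rfl⟩

/-- Continuity into the compact-open topology follows from joint continuity of the uncurried map.
Together with continuity of radius and center, this lets homotopies be checked on coordinates. -/
theorem continuous_mk {Z : Type*} [TopologicalSpace Z] {r : Z → ℝ} {b : Z → E m}
    (hr : Continuous r) (hb : Continuous b) (h₀ : ∀ z, 0 < r z) (h₁ : ∀ z, ‖b z‖ + r z ≤ 1) :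
    Continuous fun z => mk (r z) (b z) (h₀ z) (h₁ z) := by
  refine Continuous.subtype_mk (ContinuousMap.continuous_of_continuous_uncurry _ ?_) _
  refine Continuous.subtype_mk ?_ _
  change Continuous fun p : Z × Disc m => r p.1 • (p.2 : E m) + b p.1
  fun_prop

theorem continuous_center : Continuous (center : Rect m → E m) :=
  continuous_subtype_val.comp ((continuous_eval_const _).comp continuous_subtype_val)

@[simp] theorem center_mk (r : ℝ) (b : E m) (hr : 0 < r) (h : ‖b‖ + r ≤ 1) :
    (mk r b hr h).center = b := by
  simp [mk, center]

@[simp] theorem center_one : (1 : Rect m).center = 0 := rfl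

theorem center_mul (f g : Rect m) : (f * g).center = f.radius • g.center + f.center :=
  f.apply_eq _

theorem ext {f g : Rect m} (hr : f.radius = g.radius) (hc : f.center = g.center) : f = g := by
  refine Subtype.ext (ContinuousMap.ext fun x => Subtype.ext ?_)
  rw [f.apply_eq, g.apply_eq, hr, hc]

theorem image_eq (f : Rect m) : f.image = Metric.closedBall f.center f.radius := by
  have := f.radius_pos
  ext y
  rw [image, mem_closedBall_iff_norm]
  constructor
  · rintro ⟨x, rfl⟩
    have hx : ‖(x : E m)‖ ≤ 1 := mem_closedBall_zero_iff.1 x.2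
    dsimp only
    rw [f.apply_eq, add_sub_cancel_right, norm_smul, Real.norm_of_nonneg this.le]
    nlinarith
  · intro hy
    refine ⟨⟨f.radius⁻¹ • (y - f.center), ?_⟩, ?_⟩
    · rw [mem_closedBall_zero_iff, norm_smul, norm_inv, Real.norm_of_nonneg this.le]
      rwa [inv_mul_le_one₀ this]
    · dsimp only
      rw [f.apply_eq, smul_smul, mul_inv_cancel₀ this.ne', one_smul, sub_add_cancel]

variable [NeZero m]

theorem exists_norm_eq_one (b : E m) : ∃ u : E m, ‖u‖ = 1 ∧ b = ‖b‖ • u := by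
  by_cases h : b = 0
  · exact ⟨EuclideanSpace.single 0 1, by simp, by simp [h]⟩
  · exact ⟨‖b‖⁻¹ • b, norm_smul_inv_norm h, by
      rw [smul_smul, mul_inv_cancel₀ (norm_ne_zero_iff.2 h), one_smul]⟩

/-- A point of the unit sphere. -/
noncomputable def pole (m : ℕ) [NeZero m] : Disc m := ⟨EuclideanSpace.single 0 1, by simp⟩

/-- The radius was obtained by choice; its value at a boundary point shows that the map determines
it, continuously. In dimension zero there is no such point and the scaling factor is not determined.
-/
theorem radius_eq (f : Rect m) : f.radius = ‖(f.1 (pole m) : E m) - f.center‖ := by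
  rw [f.apply_eq, add_sub_cancel_right, norm_smul, Real.norm_of_nonneg f.radius_pos.le]
  simp [pole]

theorem continuous_radius : Continuous (radius : Rect m → ℝ) := by
  simp_rw [funext radius_eq]
  refine Continuous.norm (Continuous.sub (continuous_subtype_val.comp ?_) continuous_center)
  exact (continuous_eval_const _).comp continuous_subtype_val

theorem radius_eq_of_apply {f : Rect m} {r : ℝ} (hr : 0 < r) {b : E m}
    (h : ∀ x : Disc m, (f.1 x : E m) = r • (x : E m) + b) : f.radius = r := by
  rw [radius_eq, center, h, h]
  simp [pole, norm_smul, abs_of_pos hr]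

@[simp] theorem radius_mk (r : ℝ) (b : E m) (hr : 0 < r) (h : ‖b‖ + r ≤ 1) :
    (mk r b hr h).radius = r :=
  radius_eq_of_apply hr fun _ => rfl

@[simp] theorem radius_one : (1 : Rect m).radius = 1 :=
  radius_eq_of_apply (b := 0) one_pos fun x => by rw [one_smul, add_zero]; rfl

theorem radius_mul (f g : Rect m) : (f * g).radius = f.radius * g.radius :=
  radius_eq_of_apply (b := f.radius • g.center + f.center) (mul_pos f.radius_pos g.radius_pos)
    fun x => by
      rw [← smul_smul, ← add_assoc, ← smul_add, ← g.apply_eq]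
      exact f.apply_eq (g.1 x)

/-- The boundary point in the direction of the center is sent to a vector of norm ‖center‖ + radius,
which still lies in the unit disc. -/
theorem norm_center_add_radius_le (f : Rect m) : ‖f.center‖ + f.radius ≤ 1 := by
  obtain ⟨u, hu, h⟩ := exists_norm_eq_one f.center
  have h1 : ‖(f.1 ⟨u, by simp [hu]⟩ : E m)‖ ≤ 1 := mem_closedBall_zero_iff.1 (f.1 _).2
  rw [f.apply_eq] at h1
  dsimp only at h1
  rw [h, ← add_smul, norm_smul, hu, mul_one] at h1
  linarith [(le_abs_self _).trans h1]

omit [NeZero m] in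
theorem disjoint_interior_image_iff (f g : Rect m) :
    Disjoint (interior f.image) (interior g.image) ↔
      f.radius + g.radius ≤ ‖f.center - g.center‖ := by
  rw [image_eq, image_eq, interior_closedBall _ f.radius_pos.ne',
    interior_closedBall _ g.radius_pos.ne', disjoint_ball_ball_iff f.radius_pos g.radius_pos,
    dist_eq_norm]

end Rect

/-! ### Causal disjointness of discs -/

section Minkowski

variable {m : ℕ}

/-- The time coordinate. -/
noncomputable def time : E (m + 1) →L[ℝ] ℝ := EuclideanSpace.proj 0

/-- The space coordinates. -/
noncomputable def spatial : E (m + 1) →L[ℝ] E m :=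
  (EuclideanSpace.equiv (Fin m) ℝ).symm.toContinuousLinearMap ∘L
    ContinuousLinearMap.pi fun i => EuclideanSpace.proj i.succ

/-- The point with given time and space coordinates. -/
noncomputable def event (t : ℝ) (y : E m) : E (m + 1) := WithLp.toLp 2 (Fin.cons t y)

@[simp] theorem time_event (t : ℝ) (y : E m) : time (event t y) = t := rfl

@[simp] theorem spatial_event (t : ℝ) (y : E m) : spatial (event t y) = y := by
  ext i; rfl

theorem event_time_spatial (x : E (m + 1)) : event (time x) (spatial x) = x := by
  ext i
  refine Fin.cases rfl (fun j => rfl) i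

theorem norm_sq_eq (x : E (m + 1)) : ‖x‖ ^ 2 = time x ^ 2 + ‖spatial x‖ ^ 2 := by
  simp [EuclideanSpace.norm_sq_eq, Fin.sum_univ_succ, time, spatial]

theorem minkowski_self (x : E (m + 1)) : minkowski x x = ‖spatial x‖ ^ 2 - time x ^ 2 := by
  simp [minkowski, EuclideanSpace.norm_sq_eq, Fin.sum_univ_succ, time, spatial]
  ring_nf

theorem norm_spatial_le (x : E (m + 1)) : ‖spatial x‖ ≤ ‖x‖ :=
  abs_le_of_sq_le_sq' (by nlinarith [norm_sq_eq x, sq_nonneg (time x)]) (norm_nonneg _) |>.2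

theorem minkowski_self_nonpos {x : E (m + 1)} : minkowski x x ≤ 0 ↔ ‖spatial x‖ ≤ |time x| := by
  rw [minkowski_self, sub_nonpos, sq_le_sq, abs_norm]

theorem abs_time_add_norm_spatial_le (x : E (m + 1)) :
    |time x| + ‖spatial x‖ ≤ √2 * ‖x‖ := by
  refine abs_le_of_sq_le_sq' ?_ (by positivity) |>.2
  rw [mul_pow, Real.sq_sqrt zero_le_two, norm_sq_eq, ← sq_abs (time x)]
  nlinarith [sq_nonneg (|time x| - ‖spatial x‖)]

theorem continuous_event {Z : Type*} [TopologicalSpace Z] {t : Z → ℝ} {y : Z → E m}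
    (ht : Continuous t) (hy : Continuous y) : Continuous fun z => event (t z) (y z) := by
  refine (PiLp.continuous_toLp 2 _).comp (continuous_pi fun i => ?_)
  refine Fin.cases ht (fun j => ?_) i
  exact (EuclideanSpace.proj (𝕜 := ℝ) j).continuous.comp hy

/-- The time derivative of a causal curve never vanishes: if it did, the spatial velocity and hence
the whole velocity would be zero. By Darboux's theorem it has constant sign, without any continuity
of the velocity, and the mean value inequality then bounds spatial by temporal displacement. -/
theorem IsCausalCurveOn.norm_spatial_sub_le {γ : ℝ → E (m + 1)} {a b : ℝ} (hab : a ≤ b)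
    (h : IsCausalCurveOn γ a b) : ‖spatial (γ b - γ a)‖ ≤ |time (γ b - γ a)| := by
  choose! v hv hv0 hvm using h
  have ht : ∀ t ∈ Set.Icc a b,
      HasDerivWithinAt (fun t => time (γ t)) (time (v t)) (Set.Icc a b) t :=
    fun t h => time.hasFDerivAt.comp_hasDerivWithinAt t (hv t h)
  have hs : ∀ t ∈ Set.Icc a b,
      HasDerivWithinAt (fun t => spatial (γ t)) (spatial (v t)) (Set.Icc a b) t :=
    fun t h => spatial.hasFDerivAt.comp_hasDerivWithinAt t (hv t h)
  have hle : ∀ t ∈ Set.Icc a b, ‖spatial (v t)‖ ≤ |time (v t)| := fun t h =>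
    minkowski_self_nonpos.1 (hvm t h)
  have hne : ∀ t ∈ Set.Icc a b, time (v t) ≠ 0 := fun t h h0 => hv0 t h <| by
    have h1 := hle t h
    rw [h0, abs_zero] at h1
    rw [← norm_eq_zero, ← sq_eq_zero_iff, norm_sq_eq, h0, le_antisymm h1 (norm_nonneg _)]
    simp
  -- The mean value inequality is stated for right derivatives, so derivatives within the interval
  -- are converted.
  have hIci : ∀ {F : Type} [NormedAddCommGroup F] [NormedSpace ℝ F] {f : ℝ → F} {f' : F} {t : ℝ},
      t ∈ Set.Ico a b → HasDerivWithinAt f f' (Set.Icc a b) t →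
        HasDerivWithinAt f f' (Set.Ici t) t := fun ht h =>
    h.mono_of_mem_nhdsWithin (Filter.mem_of_superset (Icc_mem_nhdsGE ht.2)
      (Set.Icc_subset_Icc_left ht.1))
  -- the mean value inequality for curves with monotone time `ε * time`
  have key : ∀ ε : ℝ, (∀ t ∈ Set.Icc a b, |time (v t)| = ε * time (v t)) →
      ‖spatial (γ b) - spatial (γ a)‖ ≤ ε * (time (γ b) - time (γ a)) := fun ε hε =>
    image_norm_le_of_norm_deriv_right_le_deriv_boundary'
      (f := fun t => spatial (γ t) - spatial (γ a)) (f' := fun t => spatial (v t))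
      (B := fun t => ε * (time (γ t) - time (γ a))) (B' := fun t => ε * time (v t))
      (fun t h => ((hs t h).sub_const _).continuousWithinAt)
      (fun t h => hIci h ((hs t (Set.Ico_subset_Icc_self h)).sub_const _)) (by simp)
      (fun t h => (((ht t h).sub_const _).const_mul ε).continuousWithinAt)
      (fun t h => hIci h (((ht t (Set.Ico_subset_Icc_self h)).sub_const _).const_mul ε))
      (fun t h => (hle t (Set.Ico_subset_Icc_self h)).trans
        (hε t (Set.Ico_subset_Icc_self h)).le)
      (Set.right_mem_Icc.2 hab)
  rw [map_sub, map_sub]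
  rcases hasDerivWithinAt_forall_lt_or_forall_gt_of_forall_ne (convex_Icc a b) ht hne with h | h
  · refine (key (-1) fun t ht => ?_).trans ?_
    · rw [abs_of_neg (h t ht), neg_one_mul]
    · rw [neg_one_mul]; exact neg_le_abs _
  · refine (key 1 fun t ht => ?_).trans ?_
    · rw [abs_of_pos (h t ht), one_mul]
    · rw [one_mul]; exact le_abs_self _

theorem causallyJoined_iff {p q : E (m + 1)} :
    CausallyJoined p q ↔ ‖spatial (p - q)‖ ≤ |time (p - q)| := by
  constructor
  · rintro ⟨γ, a, b, hab, hγ, ⟨rfl, rfl⟩ | ⟨rfl, rfl⟩⟩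
    · have := hγ.norm_spatial_sub_le hab
      rwa [← neg_sub, map_neg, norm_neg, map_neg, abs_neg] at this
    · exact hγ.norm_spatial_sub_le hab
  · intro h
    by_cases hpq : p = q
    -- On a one-point interval every vector is a derivative, so a timelike one may be chosen.
    · refine ⟨fun _ => p, 0, 0, le_rfl, fun t ht => ⟨event 1 0, ?_, ?_, ?_⟩, Or.inl ⟨rfl, hpq⟩⟩
      · rw [Set.Icc_self] at ht ⊢
        exact HasFDerivWithinAt.of_subsingleton Set.subsingleton_singleton
      · intro h0
        simpa using congrArg time h0
      · simp [minkowski_self_nonpos]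
    · refine ⟨fun t => t • (p - q) + q, 0, 1, zero_le_one, fun t ht => ⟨p - q, ?_,
        sub_ne_zero.2 hpq, minkowski_self_nonpos.2 h⟩, Or.inr ⟨by simp, by simp⟩⟩
      simpa using (((hasDerivAt_id t).smul_const (p - q)).add_const q).hasDerivWithinAt

/-- Moving one point of a unit ball changes |time| and ‖spatial‖ by a total of at most √2, which
gives sufficiency. Necessity holds because a null direction attains this bound. The inequality is
strict because the balls are closed and null curves count as causal. -/
theorem causallyDisjoint_closedBall_iff [NeZero m] {b b' : E (m + 1)} {r r' : ℝ} (hr : 0 < r)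
    (hr' : 0 < r') :
    CausallyDisjoint (Metric.closedBall b r) (Metric.closedBall b' r') ↔
      |time (b - b')| + √2 * (r + r') < ‖spatial (b - b')‖ := by
  constructor
  · intro h
    by_contra! hle
    obtain ⟨u, hu, hY⟩ := Rect.exists_norm_eq_one (spatial (b - b'))
    obtain ⟨ε, hε, hT⟩ : ∃ ε : ℝ, |ε| = 1 ∧ time (b - b') = ε * |time (b - b')| := by
      rcases abs_cases (time (b - b')) with ⟨h1, -⟩ | ⟨h1, -⟩
      · exact ⟨1, by simp, by rw [h1, one_mul]⟩
      · exact ⟨-1, by simp, by rw [h1, neg_one_mul, neg_neg]⟩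
    have h2 : √2 * √2 = 2 := Real.mul_self_sqrt zero_le_two
    have h2' : 0 < √2 := by positivity
    -- The unit null vector that increases the time gap and decreases the spatial gap fastest, both
    -- at rate √2 / 2.
    set w : E (m + 1) := (√2 / 2) • event ε (-u) with hw
    have hwt : time w = √2 / 2 * ε := by simp [hw]
    have hws : spatial w = -(√2 / 2) • u := by simp [hw]
    have hwn : ‖w‖ = 1 := by
      rw [← sq_eq_sq₀ (norm_nonneg _) zero_le_one, norm_sq_eq, hwt, hws, norm_smul, hu,
        ← sq_abs (_ * ε), abs_mul, hε, Real.norm_eq_abs, abs_neg, mul_one, sq_abs]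
      nlinarith
    refine h (b + r • w) ?_ (b' - r' • w) ?_ (causallyJoined_iff.2 ?_)
    · simp [norm_smul, hwn, abs_of_pos hr]
    · simp [norm_smul, hwn, abs_of_pos hr']
    have hsub : b + r • w - (b' - r' • w) = (b - b') + (r + r') • w := by
      rw [add_smul]; abel
    have e1 : time (b + r • w - (b' - r' • w)) =
        ε * (|time (b - b')| + √2 / 2 * (r + r')) := by
      rw [hsub, map_add, map_smul, hwt, mul_add, ← hT, smul_eq_mul]; ring
    have e2 : spatial (b + r • w - (b' - r' • w)) =
        (‖spatial (b - b')‖ - √2 / 2 * (r + r')) • u := by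
      rw [hsub, map_add, map_smul, hws, sub_smul, ← hY]
      module
    rw [e1, e2, norm_smul, hu, mul_one, abs_mul, hε, one_mul, Real.norm_eq_abs]
    -- The spatial gap may have changed sign after the move. The lower bound covers that case; the
    -- upper bound is the negated inequality, as 2 · √2 / 2 = √2.
    refine le_trans (abs_le.2 ⟨?_, ?_⟩) (le_abs_self _)
    · linarith [abs_nonneg (time (b - b')), norm_nonneg (spatial (b - b'))]
    · linarith
  · intro h p hp q hq hpq
    rw [causallyJoined_iff] at hpq
    rw [mem_closedBall_iff_norm] at hp hq
    have hsub : b - b' = (p - q) - (p - b) + (q - b') := by abel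
    have e1 : ‖spatial (b - b')‖ ≤ ‖spatial (p - q)‖ + ‖spatial (p - b)‖ + ‖spatial (q - b')‖ := by
      rw [hsub, map_add, map_sub]
      exact (norm_add_le _ _).trans (by gcongr; exact norm_sub_le _ _)
    have e2 : |time (p - q)| ≤ |time (b - b')| + |time (p - b)| + |time (q - b')| := by
      have : p - q = (b - b') + (p - b) - (q - b') := by abel
      rw [this, map_sub, map_add]
      exact (abs_sub _ _).trans (by gcongr; exact abs_add_le _ _)
    have e3 := abs_time_add_norm_spatial_le (p - b)
    have e4 := abs_time_add_norm_spatial_le (q - b')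
    have e5 : √2 * ‖p - b‖ ≤ √2 * r := by gcongr
    have e6 : √2 * ‖q - b'‖ ≤ √2 * r' := by gcongr
    linarith

end Minkowski

/-! ### Projection of causally disjoint discs along time -/

section Projection

variable {m : ℕ} [NeZero m]

theorem perp_CD_iff (f g : Rect (m + 1)) : (CD (m + 1)).perp f g ↔
    |time (f.center - g.center)| + √2 * (f.radius + g.radius) <
      ‖spatial (f.center - g.center)‖ := by
  change CausallyDisjoint f.image g.image ↔ _
  rw [Rect.image_eq, Rect.image_eq, causallyDisjoint_closedBall_iff f.radius_pos g.radius_pos]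

omit [NeZero m] in
theorem perp_Discs_iff (f g : Rect m) : (Discs m).perp f g ↔
    f.radius + g.radius ≤ ‖f.center - g.center‖ :=
  Rect.disjoint_interior_image_iff f g

/-- Orthogonal projection of a disc to the space coordinates. -/
noncomputable def project (f : Rect (m + 1)) : Rect m :=
  Rect.mk f.radius (spatial f.center) f.radius_pos
    ((add_le_add_left (norm_spatial_le _) _).trans f.norm_center_add_radius_le)

@[simp] theorem radius_project (f : Rect (m + 1)) : (project f).radius = f.radius :=
  Rect.radius_mk _ _ _ _

omit [NeZero m] in
@[simp] theorem center_project (f : Rect (m + 1)) : (project f).center = spatial f.center :=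
  Rect.center_mk _ _ _ _

theorem project_one : project (1 : Rect (m + 1)) = 1 :=
  Rect.ext (by simp) (by simp)

theorem project_mul (f g : Rect (m + 1)) : project (f * g) = project f * project g :=
  Rect.ext (by simp [Rect.radius_mul]) (by simp [Rect.center_mul])

omit [NeZero m] in
theorem continuous_project : Continuous (project (m := m)) :=
  Rect.continuous_mk Rect.continuous_radius (spatial.continuous.comp Rect.continuous_center) _ _

theorem perp_project {f g : Rect (m + 1)} (h : (CD (m + 1)).perp f g) :
    (Discs m).perp (project f) (project g) := by
  rw [perp_CD_iff] at h
  rw [perp_Discs_iff, radius_project, radius_project, center_project, center_project, ← map_sub]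
  have := f.radius_pos
  have := g.radius_pos
  have h2 : (1 : ℝ) ≤ √2 := Real.one_le_sqrt.2 one_le_two
  nlinarith [abs_nonneg (time (f.center - g.center))]

/-- Orthogonal projection to the space coordinates as a morphism of orthogonal monoids. -/
noncomputable def spatialHom (m : ℕ) [NeZero m] : (CD (m + 1)).Hom (Discs m) where
  toMonoidHom :=
    { toFun := project (m := m)
      map_one' := project_one
      map_mul' := project_mul }
  continuous := continuous_project
  map_perp := perp_project

omit [NeZero m] in
theorem norm_event_mul_le {u : ℝ} (h0 : 0 ≤ u) (h1 : u ≤ 1) (x : E (m + 1)) :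
    ‖event (u * time x) (spatial x)‖ ≤ ‖x‖ := by
  refine abs_le_of_sq_le_sq' ?_ (norm_nonneg _) |>.2
  rw [norm_sq_eq, norm_sq_eq x, time_event, spatial_event, mul_pow]
  have : u ^ 2 ≤ 1 := pow_le_one₀ h0 h1
  nlinarith [sq_nonneg (time x)]

/-- The disc flattened in time by the factor `u` and shrunk by the factor `(1 + u) / 2`. -/
noncomputable def flatten (u : I) (f : Rect (m + 1)) : Rect (m + 1) :=
  Rect.mk ((1 + u) / 2 * f.radius) (event (u * time f.center) (spatial f.center))
    (mul_pos (by linarith [u.2.1]) f.radius_pos) (by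
      have := norm_event_mul_le u.2.1 u.2.2 f.center
      nlinarith [f.norm_center_add_radius_le, f.radius_pos, u.2.2])

/-- The disc of half the radius centered on the time zero slice. -/
noncomputable def thicken (f : Rect m) : Rect (m + 1) :=
  Rect.mk (f.radius / 2) (event 0 f.center) (half_pos f.radius_pos) (by
    have : ‖event 0 f.center‖ = ‖f.center‖ := by
      rw [← sq_eq_sq₀ (norm_nonneg _) (norm_nonneg _), norm_sq_eq]
      simp
    linarith [f.norm_center_add_radius_le, f.radius_pos])

/-- The disc shrunk by the factor `(1 + u) / 2`. -/
noncomputable def shrink (u : I) (f : Rect m) : Rect m :=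
  Rect.mk ((1 + u) / 2 * f.radius) f.center (mul_pos (by linarith [u.2.1]) f.radius_pos) (by
    nlinarith [f.norm_center_add_radius_le, f.radius_pos, u.2.2])

/-- Any shrinking factor below 1 / √2 would serve. Positivity of the radii turns the weak inequality
for disjoint interiors into the strict causal one. -/
theorem perp_thicken {f g : Rect m} (h : (Discs m).perp f g) :
    (CD (m + 1)).perp (thicken f) (thicken g) := by
  rw [perp_Discs_iff] at h
  rw [perp_CD_iff]
  have := f.radius_pos
  have := g.radius_pos
  have h2 : √2 < 2 := (Real.sqrt_lt' two_pos).2 (by norm_num)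
  simp only [thicken, Rect.radius_mk, Rect.center_mk, map_sub, time_event, spatial_event,
    sub_self, abs_zero]
  nlinarith

/-- Time gap and radii are multiplied by factors at most 1 while the spatial gap is unchanged. -/
theorem perp_flatten (u : I) {f g : Rect (m + 1)} (h : (CD (m + 1)).perp f g) :
    (CD (m + 1)).perp (flatten u f) (flatten u g) := by
  rw [perp_CD_iff] at h ⊢
  have hf := f.radius_pos
  have hg := g.radius_pos
  simp only [flatten, Rect.radius_mk, Rect.center_mk, map_sub, time_event, spatial_event,
    ← mul_sub, ← mul_add, abs_mul, abs_of_nonneg u.2.1] at h ⊢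
  refine lt_of_le_of_lt (add_le_add (mul_le_of_le_one_left (abs_nonneg _) u.2.2)
    (mul_le_mul_of_nonneg_left (mul_le_of_le_one_left (by positivity) ?_)
      (Real.sqrt_nonneg 2))) h
  linarith [u.2.2]

theorem perp_shrink (u : I) {f g : Rect m} (h : (Discs m).perp f g) :
    (Discs m).perp (shrink u f) (shrink u g) := by
  rw [perp_Discs_iff] at h ⊢
  have := f.radius_pos
  have := g.radius_pos
  simp only [shrink, Rect.radius_mk, Rect.center_mk]
  nlinarith [u.2.2]

theorem flatten_zero (f : Rect (m + 1)) : flatten 0 f = thicken (project f) := by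
  refine Rect.ext ?_ ?_
  · simp [flatten, thicken]; ring
  · simp [flatten, thicken]

omit [NeZero m] in
theorem flatten_one (f : Rect (m + 1)) : flatten 1 f = f := by
  refine Rect.ext ?_ ?_ <;> simp [flatten, event_time_spatial]

theorem shrink_zero (f : Rect m) : shrink 0 f = project (thicken f) := by
  refine Rect.ext ?_ ?_
  · simp [shrink, thicken]; ring
  · simp [shrink, thicken]

theorem shrink_one (f : Rect m) : shrink 1 f = f := by
  refine Rect.ext ?_ ?_ <;> simp [shrink]

theorem continuous_thicken : Continuous (thicken (m := m)) :=
  Rect.continuous_mk (Rect.continuous_radius.div_const 2)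
    (continuous_event continuous_const Rect.continuous_center) _ _

omit [NeZero m] in
theorem continuous_flatten : Continuous fun p : I × Rect (m + 1) => flatten p.1 p.2 := by
  have h1 := Rect.continuous_radius (m := m + 1)
  have h2 := Rect.continuous_center (m := m + 1)
  refine Rect.continuous_mk ?_ (continuous_event ?_ ?_) _ _
  all_goals fun_prop

theorem continuous_shrink : Continuous fun p : I × Rect m => shrink p.1 p.2 := by
  have h1 := Rect.continuous_radius (m := m)
  have h2 := Rect.continuous_center (m := m)
  refine Rect.continuous_mk ?_ ?_ _ _
  all_goals fun_prop

theorem spatialHom_isEquivalence : (spatialHom m).prefact.IsEquivalence :=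
  OrthMonoid.Hom.isEquivalence (spatialHom m) (thicken (m := m)) continuous_thicken
    (fun _ _ => perp_thicken (m := m))
    ⟨fun p => flatten (m := m) p.1 p.2, continuous_flatten, fun u _ _ => perp_flatten u,
      flatten_zero (m := m), flatten_one (m := m)⟩
    ⟨fun p => shrink (m := m) p.1 p.2, continuous_shrink, fun u _ _ => perp_shrink u,
      shrink_zero (m := m), shrink_one (m := m)⟩

end Projection

/-! ### Coordinates on rectilinear embeddings of cubes -/

namespace CubeEmb

variable {m : ℕ}

/-- The image of the origin. -/
def center (f : CubeEmb m) : Fin m → ℝ :=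
  f.1 ⟨0, fun _ => neg_nonpos.2 zero_le_one, fun _ => zero_le_one⟩

/-- The vector of scaling factors. -/
noncomputable def scale (f : CubeEmb m) : Fin m → ℝ := f.2.choose

theorem scale_pos (f : CubeEmb m) (i : Fin m) : 0 < f.scale i := f.2.choose_spec.1 i

theorem apply_eq (f : CubeEmb m) (x : Cube m) :
    (f.1 x : Fin m → ℝ) = f.scale * (x : Fin m → ℝ) + f.center := by
  obtain ⟨b, hb⟩ := f.2.choose_spec.2
  have h0 : f.center = b := by rw [center, hb]; simp
  rw [h0, hb]; rfl

/-- The corner of the cube where all coordinates are `1`. -/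
def corner (m : ℕ) : Cube m := ⟨1, fun _ => neg_le_self zero_le_one, le_rfl⟩

theorem scale_eq (f : CubeEmb m) : f.scale = (f.1 (corner m) : Fin m → ℝ) - f.center := by
  rw [f.apply_eq, add_sub_cancel_right]
  exact (mul_one _).symm

theorem scale_eq_of_apply {f : CubeEmb m} {a b : Fin m → ℝ}
    (h : ∀ x : Cube m, (f.1 x : Fin m → ℝ) = a * (x : Fin m → ℝ) + b) : f.scale = a := by
  rw [scale_eq, center, h, h]
  simp [corner]

theorem abs_center_add_scale_le (f : CubeEmb m) (i : Fin m) : |f.center i| + f.scale i ≤ 1 := by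
  have h1 := (f.1 (corner m)).2.2 i
  have h2 := (f.1 ⟨-1, le_rfl, fun _ => neg_le_self zero_le_one⟩).2.1 i
  rw [f.apply_eq] at h1 h2
  simp [corner] at h1 h2
  rw [← le_sub_iff_add_le, abs_le]
  constructor <;> linarith

/-- The embedding with given scaling factors and center. -/
def mk (a b : Fin m → ℝ) (ha : ∀ i, 0 < a i) (h : ∀ i, |b i| + a i ≤ 1) : CubeEmb m :=
  ⟨⟨fun x => ⟨a * (x : Fin m → ℝ) + b, by
      have key : ∀ i, |a i * (x : Fin m → ℝ) i + b i| ≤ 1 := fun i => by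
        have hx : |(x : Fin m → ℝ) i| ≤ 1 := abs_le.2 ⟨x.2.1 i, x.2.2 i⟩
        have := abs_add_le (a i * (x : Fin m → ℝ) i) (b i)
        rw [abs_mul, abs_of_pos (ha i)] at this
        nlinarith [h i, ha i]
      exact ⟨fun i => (abs_le.1 (key i)).1, fun i => (abs_le.1 (key i)).2⟩⟩,
    by fun_prop⟩, a, ha, b, fun _ => rfl⟩

@[simp] theorem scale_mk (a b : Fin m → ℝ) (ha : ∀ i, 0 < a i) (h : ∀ i, |b i| + a i ≤ 1) :
    (mk a b ha h).scale = a :=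
  scale_eq_of_apply fun _ => rfl

@[simp] theorem center_mk (a b : Fin m → ℝ) (ha : ∀ i, 0 < a i) (h : ∀ i, |b i| + a i ≤ 1) :
    (mk a b ha h).center = b := by
  simp [mk, center]

@[simp] theorem center_one : (1 : CubeEmb m).center = 0 := rfl

@[simp] theorem scale_one : (1 : CubeEmb m).scale = 1 :=
  scale_eq_of_apply (b := 0) fun x => by rw [one_mul, add_zero]; rfl

theorem center_mul (f g : CubeEmb m) : (f * g).center = f.scale * g.center + f.center :=
  f.apply_eq _

theorem scale_mul (f g : CubeEmb m) : (f * g).scale = f.scale * g.scale :=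
  scale_eq_of_apply (b := f.scale * g.center + f.center) fun x => by
    rw [mul_assoc, ← add_assoc, ← mul_add, ← g.apply_eq]
    exact f.apply_eq (g.1 x)

theorem ext {f g : CubeEmb m} (hs : f.scale = g.scale) (hc : f.center = g.center) : f = g := by
  refine Subtype.ext (ContinuousMap.ext fun x => Subtype.ext ?_)
  rw [f.apply_eq, g.apply_eq, hs, hc]

theorem continuous_mk {Z : Type*} [TopologicalSpace Z] {a b : Z → Fin m → ℝ}
    (ha : Continuous a) (hb : Continuous b) (h₀ : ∀ z i, 0 < a z i)
    (h₁ : ∀ z i, |b z i| + a z i ≤ 1) :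
    Continuous fun z => mk (a z) (b z) (h₀ z) (h₁ z) := by
  refine Continuous.subtype_mk (ContinuousMap.continuous_of_continuous_uncurry _ ?_) _
  refine Continuous.subtype_mk ?_ _
  change Continuous fun p : Z × Cube m => a p.1 * (p.2 : Fin m → ℝ) + b p.1
  fun_prop

theorem continuous_center : Continuous (center : CubeEmb m → Fin m → ℝ) :=
  continuous_subtype_val.comp ((continuous_eval_const _).comp continuous_subtype_val)

theorem continuous_scale : Continuous (scale : CubeEmb m → Fin m → ℝ) := by
  simp_rw [funext scale_eq]
  refine Continuous.sub (continuous_subtype_val.comp ?_) continuous_center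
  exact (continuous_eval_const _).comp continuous_subtype_val

theorem image_eq (f : CubeEmb m) :
    f.image = Set.Icc (f.center - f.scale) (f.center + f.scale) := by
  ext y
  constructor
  · rintro ⟨x, rfl⟩
    dsimp only
    rw [f.apply_eq]
    constructor <;> intro i <;> have h1 := x.2.1 i <;> have h2 := x.2.2 i <;>
      have := f.scale_pos i <;> simp at h1 h2 ⊢ <;> nlinarith
  · rintro ⟨h1, h2⟩
    refine ⟨⟨fun i => (y i - f.center i) / f.scale i, fun i => ?_, fun i => ?_⟩, ?_⟩
    · have := h1 i
      simp only [Pi.neg_apply, Pi.one_apply, Pi.sub_apply] at this ⊢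
      rw [le_div_iff₀ (f.scale_pos i)]
      linarith
    · have := h2 i
      simp only [Pi.one_apply, Pi.add_apply] at this ⊢
      rw [div_le_one (f.scale_pos i)]
      linarith
    · dsimp only
      rw [f.apply_eq]
      ext i
      simp [mul_div_cancel₀ _ (f.scale_pos i).ne']

theorem interior_image (f : CubeEmb m) : interior f.image =
    Set.univ.pi fun i => Set.Ioo (f.center i - f.scale i) (f.center i + f.scale i) := by
  rw [image_eq, ← Set.pi_univ_Icc, interior_pi_set Set.finite_univ]
  simp [interior_Icc]

end CubeEmb

theorem perp_Cubes_iff {m : ℕ} (f g : CubeEmb m) : (Cubes m).perp f g ↔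
    ∃ i, f.scale i + g.scale i ≤ |f.center i - g.center i| := by
  change Disjoint (interior f.image) (interior g.image) ↔ _
  rw [f.interior_image, g.interior_image, Set.disjoint_univ_pi]
  refine exists_congr fun i => ?_
  have hf := f.scale_pos i
  have hg := g.scale_pos i
  -- Two of the four resulting cases compare an interval's right end with its own left end and
  -- contradict positivity of the scales.
  rw [Set.Ioo_disjoint_Ioo, min_le_iff, le_max_iff, le_max_iff, le_abs]
  constructor
  · rintro ((h | h) | (h | h))
    · linarith
    · right; linarith
    · left; linarith
    · linarith
  · rintro (h | h)
    · right; left; linarith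
    · left; right; linarith

/-! ### Interpolation between the Euclidean norm and the maximum norm -/

section InterpNorm

variable {m : ℕ}

/-- The convex combination `(1 - s) ‖x‖₂ + s ‖x‖_∞`. -/
noncomputable def interpNorm (s : I) (x : E m) : ℝ := (1 - s) * ‖x‖ + s * ‖WithLp.ofLp x‖

theorem interpNorm_add_le (s : I) (x y : E m) :
    interpNorm s (x + y) ≤ interpNorm s x + interpNorm s y := by
  have h1 := mul_le_mul_of_nonneg_left (norm_add_le x y) (sub_nonneg.2 s.2.2)
  have h2 := mul_le_mul_of_nonneg_left (norm_add_le (WithLp.ofLp x) (WithLp.ofLp y)) s.2.1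
  rw [interpNorm, interpNorm, interpNorm, WithLp.ofLp_add]
  linarith

theorem interpNorm_smul (s : I) {r : ℝ} (hr : 0 ≤ r) (x : E m) :
    interpNorm s (r • x) = r * interpNorm s x := by
  rw [interpNorm, interpNorm, WithLp.ofLp_smul, norm_smul, norm_smul, Real.norm_of_nonneg hr]
  ring

@[simp] theorem interpNorm_vec_zero (s : I) : interpNorm s (0 : E m) = 0 := by simp [interpNorm]

@[simp] theorem interpNorm_zero (x : E m) : interpNorm 0 x = ‖x‖ := by simp [interpNorm]

@[simp] theorem interpNorm_one (x : E m) : interpNorm 1 x = ‖WithLp.ofLp x‖ := by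
  simp [interpNorm]

theorem interpNorm_neg (s : I) (x : E m) : interpNorm s (-x) = interpNorm s x := by
  simp [interpNorm]

theorem interpNorm_sub_rev (s : I) (x y : E m) : interpNorm s (x - y) = interpNorm s (y - x) := by
  rw [← interpNorm_neg, neg_sub]

theorem norm_ofLp_le (x : E m) : ‖WithLp.ofLp x‖ ≤ ‖x‖ :=
  (pi_norm_le_iff_of_nonneg (norm_nonneg _)).2 fun i => PiLp.norm_apply_le x i

theorem norm_le_mul_norm_ofLp (x : E m) : ‖x‖ ≤ m * ‖WithLp.ofLp x‖ := by
  refine abs_le_of_sq_le_sq' ?_ (by positivity) |>.2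
  have h : ∀ i, ‖x i‖ ^ 2 ≤ ‖WithLp.ofLp x‖ ^ 2 := fun i =>
    pow_le_pow_left₀ (norm_nonneg _) (norm_le_pi_norm (WithLp.ofLp x) i) 2
  have h2 : (m : ℝ) ≤ m ^ 2 := by exact_mod_cast Nat.le_self_pow two_ne_zero m
  calc ‖x‖ ^ 2 ≤ m * ‖WithLp.ofLp x‖ ^ 2 := by
        rw [EuclideanSpace.norm_sq_eq]
        exact (Finset.sum_le_sum fun i _ => h i).trans (by simp)
    _ ≤ (m * ‖WithLp.ofLp x‖) ^ 2 := by
        rw [mul_pow]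
        gcongr

/-- A bound for the ratio of two interpolated norms. -/
noncomputable def distortion (m : ℕ) (s t : I) : ℝ := 1 + m * |(s : ℝ) - t|

theorem one_le_distortion (s t : I) : 1 ≤ distortion m s t :=
  le_add_of_nonneg_right (by positivity)

theorem distortion_pos (s t : I) : 0 < distortion m s t :=
  one_pos.trans_le (one_le_distortion s t)

@[simp] theorem distortion_self (s : I) : distortion m s s = 1 := by simp [distortion]

theorem distortion_comm (s t : I) : distortion m s t = distortion m t s := by
  rw [distortion, abs_sub_comm, distortion]

theorem continuous_distortion : Continuous fun p : I × I => distortion m p.1 p.2 := by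
  unfold distortion
  fun_prop

/-- The two norms of x differ by (t - s) (‖x‖₂ - ‖x‖_∞), and ‖x‖₂ ≤ m ‖x‖_∞ ≤ m N_t(x). It matters
that the factor is continuous in (s, t) and equals 1 on the diagonal, so that nothing is shrunk
where the norms agree. -/
theorem interpNorm_le_distortion_mul (s t : I) (x : E m) :
    interpNorm s x ≤ distortion m s t * interpNorm t x := by
  have h1 := norm_ofLp_le x
  have h2 := norm_le_mul_norm_ofLp x
  have h3 : ‖WithLp.ofLp x‖ ≤ interpNorm t x := by
    unfold interpNorm
    nlinarith [t.2.1, t.2.2]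
  have h4 : interpNorm s x - interpNorm t x = ((t : ℝ) - s) * (‖x‖ - ‖WithLp.ofLp x‖) := by
    unfold interpNorm
    ring
  have h5 : interpNorm s x - interpNorm t x ≤ |(s : ℝ) - t| * (m * interpNorm t x) := by
    rw [h4, abs_sub_comm]
    refine mul_le_mul (le_abs_self _) ?_ (sub_nonneg.2 h1) (abs_nonneg _)
    have := mul_le_mul_of_nonneg_left h3 (Nat.cast_nonneg (α := ℝ) m)
    linarith [norm_nonneg (WithLp.ofLp x)]
  unfold distortion
  linarith

end InterpNorm

/-! ### Paths of rectilinear embeddings from a disc to a cube -/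

/-- Continuous families of rectilinear self-embeddings `x ↦ r s • x + y s`, `s ∈ [0, 1]`, of the
unit balls of the interpolated norms. -/
def DiscPath (m : ℕ) : Type :=
  {c : C(I, ℝ × E m) // ∀ s, 0 < (c s).1 ∧ interpNorm s (c s).2 + (c s).1 ≤ 1}

instance (m : ℕ) : TopologicalSpace (DiscPath m) := inferInstanceAs (TopologicalSpace (Subtype _))

namespace DiscPath

variable {m : ℕ}

/-- The scaling factors along the path. -/
def radius (c : DiscPath m) (s : I) : ℝ := (c.1 s).1

/-- The centers along the path. -/
def center (c : DiscPath m) (s : I) : E m := (c.1 s).2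

theorem radius_pos (c : DiscPath m) (s : I) : 0 < c.radius s := (c.2 s).1

theorem interpNorm_center_add_radius_le (c : DiscPath m) (s : I) :
    interpNorm s (c.center s) + c.radius s ≤ 1 := (c.2 s).2

theorem ext {c d : DiscPath m} (hr : ∀ s, c.radius s = d.radius s)
    (hc : ∀ s, c.center s = d.center s) : c = d :=
  Subtype.ext (ContinuousMap.ext fun s => Prod.ext (hr s) (hc s))

/-- Evaluation is jointly continuous because the interval is locally compact. -/
theorem continuous_uncurry : Continuous fun p : DiscPath m × I => p.1.1 p.2 :=
  continuous_eval.comp ((continuous_subtype_val.comp continuous_fst).prodMk continuous_snd)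

theorem continuous_radius : Continuous fun p : DiscPath m × I => p.1.radius p.2 :=
  continuous_fst.comp continuous_uncurry

theorem continuous_center : Continuous fun p : DiscPath m × I => p.1.center p.2 :=
  continuous_snd.comp continuous_uncurry

theorem continuous_of_uncurry {Z : Type*} [TopologicalSpace Z] {F : Z → DiscPath m}
    (hr : Continuous fun p : Z × I => (F p.1).radius p.2)
    (hc : Continuous fun p : Z × I => (F p.1).center p.2) : Continuous F :=
  continuous_induced_rng.2 (ContinuousMap.continuous_of_continuous_uncurry _ (hr.prodMk hc))

instance (m : ℕ) : Monoid (DiscPath m) where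
  one := ⟨ContinuousMap.const _ (1, 0), fun s => by simp⟩
  mul f g := ⟨⟨fun s => ((f.1 s).1 * (g.1 s).1, (f.1 s).1 • (g.1 s).2 + (f.1 s).2), by fun_prop⟩,
    fun s => by
      refine ⟨mul_pos (f.2 s).1 (g.2 s).1, ?_⟩
      have h := interpNorm_add_le s ((f.1 s).1 • (g.1 s).2) (f.1 s).2
      rw [interpNorm_smul s (f.2 s).1.le] at h
      change interpNorm s ((f.1 s).1 • (g.1 s).2 + (f.1 s).2) + (f.1 s).1 * (g.1 s).1 ≤ 1
      nlinarith [f.2 s, g.2 s]⟩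
  mul_assoc f g h := ext (fun _ => mul_assoc _ _ _) fun s => by
    change ((f.1 s).1 * (g.1 s).1) • (h.1 s).2 + ((f.1 s).1 • (g.1 s).2 + (f.1 s).2) =
      (f.1 s).1 • ((g.1 s).1 • (h.1 s).2 + (g.1 s).2) + (f.1 s).2
    module
  one_mul f := ext (fun _ => one_mul _) fun s => by
    change (1 : ℝ) • (f.1 s).2 + 0 = (f.1 s).2
    simp
  mul_one f := ext (fun _ => mul_one _) fun s => by
    change (f.1 s).1 • (0 : E m) + (f.1 s).2 = (f.1 s).2
    simp

@[simp] theorem radius_one (s : I) : (1 : DiscPath m).radius s = 1 := rfl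

@[simp] theorem center_one (s : I) : (1 : DiscPath m).center s = 0 := rfl

@[simp] theorem radius_mul (f g : DiscPath m) (s : I) :
    (f * g).radius s = f.radius s * g.radius s := rfl

@[simp] theorem center_mul (f g : DiscPath m) (s : I) :
    (f * g).center s = f.radius s • g.center s + f.center s := rfl

instance (m : ℕ) : ContinuousMul (DiscPath m) where
  continuous_mul := by
    have hr := continuous_radius (m := m)
    have hc := continuous_center (m := m)
    have h1 : Continuous fun p : (DiscPath m × DiscPath m) × I => p.1.1.radius p.2 :=
      hr.comp (f := fun p : (DiscPath m × DiscPath m) × I => (p.1.1, p.2)) (by fun_prop)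
    have h2 : Continuous fun p : (DiscPath m × DiscPath m) × I => p.1.2.radius p.2 :=
      hr.comp (f := fun p : (DiscPath m × DiscPath m) × I => (p.1.2, p.2)) (by fun_prop)
    have h3 : Continuous fun p : (DiscPath m × DiscPath m) × I => p.1.1.center p.2 :=
      hc.comp (f := fun p : (DiscPath m × DiscPath m) × I => (p.1.1, p.2)) (by fun_prop)
    have h4 : Continuous fun p : (DiscPath m × DiscPath m) × I => p.1.2.center p.2 :=
      hc.comp (f := fun p : (DiscPath m × DiscPath m) × I => (p.1.2, p.2)) (by fun_prop)
    exact continuous_of_uncurry (h1.mul h2) ((h1.smul h4).add h3)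

/-- The path obtained from embeddings `x ↦ r s • x + y s` of the unit balls of the norms with
parameter `γ s`, by shrinking them to fit the norm with parameter `s`. -/
noncomputable def adjust (γ : I → I) (hγ : Continuous γ) (r : I → ℝ) (hr : Continuous r)
    (y : I → E m) (hy : Continuous y) (h₀ : ∀ s, 0 < r s)
    (h₁ : ∀ s, interpNorm (γ s) (y s) + r s ≤ 1) : DiscPath m :=
  -- With d the distortion, dividing centers by d keeps them within the bound for the new norm.
  -- Distances between centers can then lose a factor d² in all, one d from the division and one
  -- from the change of norm, so radii are divided by d².
  ⟨⟨fun s => ((distortion m (γ s) s ^ 2)⁻¹ * r s, (distortion m (γ s) s)⁻¹ • y s), by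
    have h : Continuous fun s => distortion m (γ s) s :=
      continuous_distortion.comp (hγ.prodMk continuous_id)
    have h0 : ∀ s, distortion m (γ s) s ≠ 0 := fun s => (distortion_pos _ _).ne'
    exact (((h.pow 2).inv₀ fun s => pow_ne_zero 2 (h0 s)).mul hr).prodMk
      ((h.inv₀ h0).smul hy)⟩, fun s => by
    have h := distortion_pos (m := m) (γ s) s
    refine ⟨mul_pos (inv_pos.2 (pow_pos h 2)) (h₀ s), ?_⟩
    change interpNorm s ((distortion m (γ s) s)⁻¹ • y s) + (distortion m (γ s) s ^ 2)⁻¹ * r s ≤ 1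
    rw [interpNorm_smul s (inv_nonneg.2 h.le)]
    refine le_trans (add_le_add ?_ (mul_le_of_le_one_left (h₀ s).le ?_)) (h₁ s)
    · rw [inv_mul_le_iff₀ h, distortion_comm]
      exact interpNorm_le_distortion_mul s (γ s) (y s)
    · exact inv_le_one_of_one_le₀ (one_le_pow₀ (one_le_distortion _ _))⟩

section adjust

variable (γ : I → I) (hγ : Continuous γ) (r : I → ℝ) (hr : Continuous r)
    (y : I → E m) (hy : Continuous y) (h₀ : ∀ s, 0 < r s)
    (h₁ : ∀ s, interpNorm (γ s) (y s) + r s ≤ 1)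

@[simp] theorem radius_adjust (s : I) : (adjust γ hγ r hr y hy h₀ h₁).radius s =
    (distortion m (γ s) s ^ 2)⁻¹ * r s := rfl

@[simp] theorem center_adjust (s : I) : (adjust γ hγ r hr y hy h₀ h₁).center s =
    (distortion m (γ s) s)⁻¹ • y s := rfl

theorem radius_adjust_add_le (r' : I → ℝ) (hr' : Continuous r') (y' : I → E m)
    (hy' : Continuous y') (h₀' : ∀ s, 0 < r' s) (h₁' : ∀ s, interpNorm (γ s) (y' s) + r' s ≤ 1)
    (h : ∀ s, r s + r' s ≤ interpNorm (γ s) (y s - y' s)) (s : I) :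
    (adjust γ hγ r hr y hy h₀ h₁).radius s + (adjust γ hγ r' hr' y' hy' h₀' h₁').radius s ≤
      interpNorm s ((adjust γ hγ r hr y hy h₀ h₁).center s -
        (adjust γ hγ r' hr' y' hy' h₀' h₁').center s) := by
  have hd := distortion_pos (m := m) (γ s) s
  simp only [radius_adjust, center_adjust]
  rw [← smul_sub, interpNorm_smul s (inv_nonneg.2 hd.le), ← mul_add, inv_mul_le_iff₀ (by positivity),
    ← mul_assoc, sq, mul_assoc, mul_assoc, mul_inv_cancel_left₀ hd.ne']
  exact (h s).trans (interpNorm_le_distortion_mul _ _ _)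

end adjust

theorem continuous_adjust {Z : Type*} [TopologicalSpace Z] {γ : Z → I → I} {r : Z → I → ℝ}
    {y : Z → I → E m} (hγ : Continuous fun p : Z × I => γ p.1 p.2)
    (hr : Continuous fun p : Z × I => r p.1 p.2) (hy : Continuous fun p : Z × I => y p.1 p.2)
    (hγ' : ∀ z, Continuous (γ z)) (hr' : ∀ z, Continuous (r z)) (hy' : ∀ z, Continuous (y z))
    (h₀ : ∀ z s, 0 < r z s) (h₁ : ∀ z s, interpNorm (γ z s) (y z s) + r z s ≤ 1) :
    Continuous fun z => adjust (γ z) (hγ' z) (r z) (hr' z) (y z) (hy' z) (h₀ z) (h₁ z) := by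
  have h : Continuous fun p : Z × I => distortion m (γ p.1 p.2) p.2 :=
    continuous_distortion.comp (hγ.prodMk continuous_snd)
  have h0 : ∀ p : Z × I, distortion m (γ p.1 p.2) p.2 ≠ 0 := fun s => (distortion_pos _ _).ne'
  exact continuous_of_uncurry (((h.pow 2).inv₀ fun s => pow_ne_zero 2 (h0 s)).mul hr)
    ((h.inv₀ h0).smul hy)

theorem continuous_radius_right (c : DiscPath m) : Continuous c.radius :=
  continuous_fst.comp c.1.continuous

theorem continuous_center_right (c : DiscPath m) : Continuous c.center :=
  continuous_snd.comp c.1.continuous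

/-- Reparametrization of a path, adjusted to fit. -/
noncomputable def slide (γ : I → I) (hγ : Continuous γ) (c : DiscPath m) : DiscPath m :=
  adjust γ hγ (fun s => c.radius (γ s)) (c.continuous_radius_right.comp hγ)
    (fun s => c.center (γ s)) (c.continuous_center_right.comp hγ) (fun _ => c.radius_pos _)
    (fun _ => c.interpNorm_center_add_radius_le _)

theorem continuous_slide {γ : I → I → I} (hγ : Continuous fun p : I × I => γ p.1 p.2)
    (hγ' : ∀ u, Continuous (γ u)) :
    Continuous fun p : I × DiscPath m => slide (γ p.1) (hγ' p.1) p.2 := by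
  have h : Continuous fun p : (I × DiscPath m) × I => γ p.1.1 p.2 :=
    hγ.comp (f := fun p : (I × DiscPath m) × I => (p.1.1, p.2)) (by fun_prop)
  have h' : Continuous fun p : (I × DiscPath m) × I => (p.1.2, γ p.1.1 p.2) :=
    (continuous_snd.comp continuous_fst).prodMk h
  exact continuous_adjust (Z := I × DiscPath m) (γ := fun p s => γ p.1 s)
    (r := fun p s => p.2.radius (γ p.1 s)) (y := fun p s => p.2.center (γ p.1 s)) h
    (continuous_radius.comp h') (continuous_center.comp h') _ _ _ _ _

theorem slide_id (c : DiscPath m) {γ : I → I} (hγ : Continuous γ) (h : ∀ s, γ s = s) :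
    slide γ hγ c = c :=
  ext (fun s => by simp [slide, h]) (fun s => by simp [slide, h])

end DiscPath

/-- The orthogonal monoid of paths from discs to cubes. -/
def DiscPaths (m : ℕ) : OrthMonoid where
  End := DiscPath m
  perp f g := ∀ s, f.radius s + g.radius s ≤ interpNorm s (f.center s - g.center s)
  symm h s := by
    rw [add_comm, interpNorm_sub_rev]
    exact h s
  stable {f₁ f₂} g h₁ h₂ h s := by
    -- A reverse triangle inequality: the gap between the outer centers is at most the gap between
    -- the inner ones plus the two displacements. Each displacement is then bounded by containment
    -- of the inner ball in the outer.
    have key : f₁.center s - f₂.center s =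
        (f₁.radius s • h₁.center s + f₁.center s - (f₂.radius s • h₂.center s + f₂.center s)) +
          (f₁.radius s • -h₁.center s + f₂.radius s • h₂.center s) := by module
    have e1 := h s
    rw [key] at e1
    have e2 := e1.trans ((interpNorm_add_le _ _ _).trans
      (add_le_add_right (interpNorm_add_le _ _ _) _))
    rw [interpNorm_smul s (f₁.radius_pos s).le, interpNorm_smul s (f₂.radius_pos s).le,
      interpNorm_neg] at e2
    have e3 : (g * f₁ * h₁).center s - (g * f₂ * h₂).center s = g.radius s •
        (f₁.radius s • h₁.center s + f₁.center s - (f₂.radius s • h₂.center s + f₂.center s)) := by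
      simp only [DiscPath.center_mul, DiscPath.radius_mul]
      module
    rw [e3, interpNorm_smul s (g.radius_pos s).le]
    simp only [DiscPath.radius_mul]
    rw [mul_assoc, mul_assoc, ← mul_add]
    refine mul_le_mul_of_nonneg_left ?_ (g.radius_pos s).le
    have e4 := mul_le_mul_of_nonneg_left (h₁.interpNorm_center_add_radius_le s)
      (f₁.radius_pos s).le
    have e5 := mul_le_mul_of_nonneg_left (h₂.interpNorm_center_add_radius_le s)
      (f₂.radius_pos s).le
    linarith

theorem perp_slide {m : ℕ} {γ : I → I} (hγ : Continuous γ) {f g : DiscPath m}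
    (h : (DiscPaths m).perp f g) : (DiscPaths m).perp (f.slide γ hγ) (g.slide γ hγ) :=
  DiscPath.radius_adjust_add_le γ hγ _ _ _ _ _ _ _ _ _ _ _ _ fun s => h (γ s)

/-! ### Evaluation at the disc end -/

section DiscEnd

variable {m : ℕ}

/-- The embedding of the disc at the start of a path. -/
noncomputable def DiscPath.toRect (c : DiscPath m) : Rect m :=
  Rect.mk (c.radius 0) (c.center 0) (c.radius_pos 0)
    (by simpa using c.interpNorm_center_add_radius_le 0)

@[simp] theorem DiscPath.center_toRect (c : DiscPath m) : c.toRect.center = c.center 0 :=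
  Rect.center_mk _ _ _ _

variable [NeZero m]

@[simp] theorem DiscPath.radius_toRect (c : DiscPath m) : c.toRect.radius = c.radius 0 :=
  Rect.radius_mk _ _ _ _

theorem DiscPath.toRect_one : (1 : DiscPath m).toRect = 1 := Rect.ext (by simp) (by simp)

theorem DiscPath.toRect_mul (f g : DiscPath m) : (f * g).toRect = f.toRect * g.toRect :=
  Rect.ext (by simp [Rect.radius_mul]) (by simp [Rect.center_mul])

omit [NeZero m] in
theorem DiscPath.continuous_toRect : Continuous (toRect (m := m)) :=
  Rect.continuous_mk (continuous_radius.comp (continuous_id.prodMk continuous_const))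
    (continuous_center.comp (continuous_id.prodMk continuous_const)) _ _

theorem perp_toRect {f g : DiscPath m} (h : (DiscPaths m).perp f g) :
    (Discs m).perp f.toRect g.toRect := by
  rw [perp_Discs_iff]
  simpa using h 0

/-- Evaluation of paths at the disc end. -/
noncomputable def toRectHom (m : ℕ) [NeZero m] : (DiscPaths m).Hom (Discs m) where
  toMonoidHom :=
    { toFun := DiscPath.toRect (m := m)
      map_one' := DiscPath.toRect_one
      map_mul' := DiscPath.toRect_mul }
  continuous := DiscPath.continuous_toRect
  map_perp := perp_toRect

/-- The path that starts at a given disc and shrinks it as needed. -/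
noncomputable def Rect.toPath (f : Rect m) : DiscPath m :=
  DiscPath.adjust (fun _ => 0) continuous_const (fun _ => f.radius) continuous_const
    (fun _ => f.center) continuous_const (fun _ => f.radius_pos)
    (fun _ => by simpa using f.norm_center_add_radius_le)

theorem Rect.continuous_toPath : Continuous (toPath (m := m)) :=
  DiscPath.continuous_adjust continuous_const (continuous_radius.comp continuous_fst)
    (continuous_center.comp continuous_fst) _ _ _ _ _

theorem perp_rect_toPath {f g : Rect m} (h : (Discs m).perp f g) :
    (DiscPaths m).perp f.toPath g.toPath :=
  DiscPath.radius_adjust_add_le _ _ _ _ _ _ _ _ _ _ _ _ _ _ fun _ => by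
    simpa using (perp_Discs_iff f g).1 h

/-- The distortion is 1 at the end where the path starts, so this composite is the identity on the
nose. -/
theorem Rect.toRect_toPath (f : Rect m) : f.toPath.toRect = f :=
  Rect.ext (by simp [toPath]) (by simp [toPath])

theorem DiscPath.slide_eq_toPath_toRect (c : DiscPath m) {γ : I → I} (hγ : Continuous γ)
    (h : ∀ s, γ s = 0) : c.slide γ hγ = c.toRect.toPath :=
  DiscPath.ext (fun s => by simp [slide, Rect.toPath, h]) (fun s => by simp [slide, Rect.toPath, h])

theorem toRectHom_isEquivalence : (toRectHom m).prefact.IsEquivalence :=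
  OrthMonoid.Hom.isEquivalence (toRectHom m) (Rect.toPath (m := m)) Rect.continuous_toPath
    (fun _ _ => perp_rect_toPath (m := m))
    -- The reparametrizations s ↦ u s contract the interval to its disc end 0.
    ⟨fun p => DiscPath.slide (m := m) (fun s => p.1 * s) (by fun_prop) p.2,
      DiscPath.continuous_slide (γ := fun u s => u * s) (by fun_prop) fun _ => by fun_prop,
      fun u _ _ => perp_slide _,
      fun c => DiscPath.slide_eq_toPath_toRect (m := m) c _ fun s => zero_mul s,
      fun c => DiscPath.slide_id (m := m) c _ fun s => one_mul s⟩
    ⟨fun p => p.2, continuous_snd, fun _ _ _ h => h,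
      fun f => (Rect.toRect_toPath (m := m) f).symm, fun _ => rfl⟩

end DiscEnd

/-! ### Evaluation at the cube end -/

section CubeEnd

variable {m : ℕ}

/-- The embedding of the cube at the end of a path. -/
noncomputable def DiscPath.toCubeEmb (c : DiscPath m) : CubeEmb m :=
  CubeEmb.mk (fun _ => c.radius 1) (WithLp.ofLp (c.center 1)) (fun _ => c.radius_pos 1) fun i =>
    (add_le_add_left ((norm_le_pi_norm (WithLp.ofLp (c.center 1)) i).trans_eq
      (interpNorm_one _).symm) _).trans (c.interpNorm_center_add_radius_le 1)

@[simp] theorem DiscPath.center_toCubeEmb (c : DiscPath m) :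
    c.toCubeEmb.center = WithLp.ofLp (c.center 1) :=
  CubeEmb.center_mk _ _ _ _

@[simp] theorem DiscPath.scale_toCubeEmb (c : DiscPath m) :
    c.toCubeEmb.scale = fun _ => c.radius 1 :=
  CubeEmb.scale_mk _ _ _ _

theorem DiscPath.toCubeEmb_one : (1 : DiscPath m).toCubeEmb = 1 :=
  CubeEmb.ext (by simp; rfl) (by simp)

theorem DiscPath.toCubeEmb_mul (f g : DiscPath m) :
    (f * g).toCubeEmb = f.toCubeEmb * g.toCubeEmb :=
  CubeEmb.ext (by simp [CubeEmb.scale_mul]; rfl) (by simp [CubeEmb.center_mul]; rfl)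

theorem DiscPath.continuous_toCubeEmb : Continuous (toCubeEmb (m := m)) :=
  CubeEmb.continuous_mk
    (continuous_pi fun _ => continuous_radius.comp (continuous_id.prodMk continuous_const))
    ((PiLp.continuous_ofLp 2 _).comp
      (continuous_center.comp (continuous_id.prodMk continuous_const))) _ _

/-- The maximum norm is below a positive bound as soon as every coordinate is, so separation in this
norm forces separation in some coordinate. -/
theorem perp_toCubeEmb {f g : DiscPath m} (h : (DiscPaths m).perp f g) :
    (Cubes m).perp f.toCubeEmb g.toCubeEmb := by
  rw [perp_Cubes_iff]
  by_contra! hlt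
  have h1 := h 1
  rw [interpNorm_one] at h1
  refine h1.not_gt ((pi_norm_lt_iff (add_pos (f.radius_pos 1) (g.radius_pos 1))).2 fun i => ?_)
  simpa using hlt i

/-- Evaluation of paths at the cube end. -/
noncomputable def toCubeHom (m : ℕ) : (DiscPaths m).Hom (Cubes m) where
  toMonoidHom :=
    { toFun := DiscPath.toCubeEmb (m := m)
      map_one' := DiscPath.toCubeEmb_one
      map_mul' := DiscPath.toCubeEmb_mul }
  continuous := DiscPath.continuous_toCubeEmb
  map_perp := perp_toCubeEmb

variable [NeZero m]

/-- The smallest scaling factor. -/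
noncomputable def CubeEmb.minScale (f : CubeEmb m) : ℝ :=
  Finset.univ.inf' ⟨0, Finset.mem_univ _⟩ f.scale

theorem CubeEmb.minScale_le (f : CubeEmb m) (i : Fin m) : f.minScale ≤ f.scale i :=
  Finset.inf'_le _ (Finset.mem_univ i)

theorem CubeEmb.minScale_pos (f : CubeEmb m) : 0 < f.minScale :=
  (Finset.lt_inf'_iff _).2 fun i _ => f.scale_pos i

theorem CubeEmb.continuous_minScale : Continuous (minScale (m := m)) :=
  Continuous.finset_inf'_apply _ fun i _ => (continuous_apply i).comp continuous_scale

theorem CubeEmb.norm_center_add_minScale_le (f : CubeEmb m) : ‖f.center‖ + f.minScale ≤ 1 := by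
  have h : ∀ i, ‖f.center i‖ ≤ 1 - f.minScale := fun i => by
    rw [Real.norm_eq_abs]
    linarith [f.abs_center_add_scale_le i, f.minScale_le i]
  linarith [(pi_norm_le_iff_of_nonempty _).2 h]

/-- The path that ends at the cube with the smallest scaling factor of a given cube. -/
noncomputable def CubeEmb.toPath (f : CubeEmb m) : DiscPath m :=
  DiscPath.adjust (fun _ => 1) continuous_const (fun _ => f.minScale) continuous_const
    (fun _ => WithLp.toLp 2 f.center) continuous_const (fun _ => f.minScale_pos)
    (fun _ => by simpa using f.norm_center_add_minScale_le)

theorem CubeEmb.continuous_toPath : Continuous (toPath (m := m)) :=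
  DiscPath.continuous_adjust continuous_const (continuous_minScale.comp continuous_fst)
    ((PiLp.continuous_toLp 2 _).comp (continuous_center.comp continuous_fst)) _ _ _ _ _

/-- One separating coordinate bounds the maximum norm of the difference of centers from below, and
the minimal scales do not exceed the scales in that coordinate. -/
theorem perp_cubeEmb_toPath {f g : CubeEmb m} (h : (Cubes m).perp f g) :
    (DiscPaths m).perp f.toPath g.toPath :=
  DiscPath.radius_adjust_add_le _ _ _ _ _ _ _ _ _ _ _ _ _ _ fun _ => by
    obtain ⟨i, hi⟩ := (perp_Cubes_iff f g).1 h
    rw [interpNorm_one]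
    exact (add_le_add (f.minScale_le i) (g.minScale_le i)).trans
      (hi.trans (norm_le_pi_norm (f.center - g.center) i))

theorem DiscPath.slide_eq_toPath_toCubeEmb (c : DiscPath m) {γ : I → I} (hγ : Continuous γ)
    (h : ∀ s, γ s = 1) : c.slide γ hγ = c.toCubeEmb.toPath := by
  have hm : c.toCubeEmb.minScale = c.radius 1 := by
    simp only [CubeEmb.minScale, scale_toCubeEmb]
    exact Finset.inf'_const _ _
  exact DiscPath.ext (fun s => by simp [slide, CubeEmb.toPath, h, hm])
    (fun s => by simp [slide, CubeEmb.toPath, h])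

/-- The cube with scaling factors moved linearly to their minimum. -/
noncomputable def CubeEmb.equalize (u : I) (f : CubeEmb m) : CubeEmb m :=
  CubeEmb.mk (fun i => (1 - u) * f.minScale + u * f.scale i) f.center
    (fun i => by nlinarith [u.2.1, u.2.2, f.minScale_pos, f.minScale_le i]) fun i => by
      nlinarith [u.2.1, u.2.2, f.abs_center_add_scale_le i, f.minScale_le i]

theorem CubeEmb.continuous_equalize :
    Continuous fun p : I × CubeEmb m => equalize p.1 p.2 := by
  have h1 := continuous_minScale (m := m)
  have h2 := continuous_center (m := m)
  have h3 := continuous_scale (m := m)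
  refine continuous_mk ?_ ?_ _ _
  all_goals fun_prop

/-- Centers stay fixed and scales only decrease, so the same coordinate keeps separating the cubes.
-/
theorem perp_equalize (u : I) {f g : CubeEmb m} (h : (Cubes m).perp f g) :
    (Cubes m).perp (f.equalize u) (g.equalize u) := by
  rw [perp_Cubes_iff] at h ⊢
  obtain ⟨i, hi⟩ := h
  refine ⟨i, ?_⟩
  simp only [CubeEmb.equalize, CubeEmb.scale_mk, CubeEmb.center_mk]
  nlinarith [u.2.2, f.minScale_le i, g.minScale_le i]

theorem CubeEmb.equalize_zero (f : CubeEmb m) : f.equalize 0 = f.toPath.toCubeEmb :=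
  CubeEmb.ext (by simp [equalize, toPath]) (by simp [equalize, toPath])

theorem CubeEmb.equalize_one (f : CubeEmb m) : f.equalize 1 = f :=
  CubeEmb.ext (by simp [equalize]) (by simp [equalize])

theorem toCubeHom_isEquivalence : (toCubeHom m).prefact.IsEquivalence :=
  OrthMonoid.Hom.isEquivalence (toCubeHom m) (CubeEmb.toPath (m := m)) CubeEmb.continuous_toPath
    (fun _ _ => perp_cubeEmb_toPath (m := m))
    -- Here the reparametrization is s ↦ 1 - u (1 - s), which contracts the interval to its cube end
    -- 1.
    ⟨fun p => DiscPath.slide (m := m) (fun s => σ (p.1 * σ s)) (by fun_prop) p.2,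
      DiscPath.continuous_slide (γ := fun u s => σ (u * σ s)) (by fun_prop) fun _ => by fun_prop,
      fun u _ _ => perp_slide _,
      fun c => DiscPath.slide_eq_toPath_toCubeEmb (m := m) c _ fun s => by simp,
      fun c => DiscPath.slide_id (m := m) c _ fun s => by simp⟩
    ⟨fun p => CubeEmb.equalize (m := m) p.1 p.2, CubeEmb.continuous_equalize,
      fun u _ _ => perp_equalize u, CubeEmb.equalize_zero (m := m), CubeEmb.equalize_one (m := m)⟩

end CubeEnd

theorem isEOperad_PDisc (m : ℕ) [NeZero m] : (PDisc m).IsEOperad m :=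
  .trans _ (DiscPaths m).prefact _ (.symm _ _ (.rel _ _ ⟨_, toRectHom_isEquivalence⟩))
    (.rel _ _ ⟨_, toCubeHom_isEquivalence⟩)

end CausalDiscs

theorem theorem4 (n : ℕ) (hn : 2 ≤ n) :
    (∃ φ : CausalDiscs.TopOperad.Hom (CausalDiscs.PCD n) (CausalDiscs.PDisc (n - 1)),
      φ.IsEquivalence) ∧
    (CausalDiscs.PDisc (n - 1)).IsEOperad (n - 1) := by
  obtain ⟨m, rfl⟩ : ∃ m, n = m + 1 := ⟨n - 1, by omega⟩
  have : NeZero m := ⟨by omega⟩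
  exact ⟨⟨(CausalDiscs.spatialHom m).prefact, CausalDiscs.spatialHom_isEquivalence⟩,
    CausalDiscs.isEOperad_PDisc m⟩
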